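/- For integers $a\ge 2$ and $b\ge 1$ let $\zeta(a,b)=\sum_{n=1}^{\infty}\sum_{m=1}^{n-1}\frac{1}{n^a m^b}$ denote the double zeta value, and let $\zeta$ of one argument denote the Riemann zeta function. For every integer $n\ge 2$, $$\sum_{k=1}^{n-1}\frac{(n+|n-2k|)!}{(n+|n-2k|)\,|n-2k|!}\,\zeta(2k,2n-2k)=\left[\frac{(1+(-2)^{1-n})\,(n-1)!}{4}+\frac{3\,(2n-1)!}{2\cdot n!}-\frac{(2n+1)!}{n\,(n+1)!}\;{}_2F_1(1,2n+2;n+2;-1)\right]\zeta(2n).$$ Here ${}_2F_1(1,2n+2;n+2;\cdot)$ is the Gaussian hypergeometric function, that is, the analytic continuation of the series $\sum_{j\ge 0}\frac{(1)_j(2n+2)_j}{(n+2)_j\,j!}z^j$ from $|z|<1$ to $\mathbb{C}\setminus[1,\infty)$ (which exists and is unique); the series itself diverges at $z=-1$. -/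

import Mathlib

/-- The double zeta value `ζ(a, b) = ∑_{n ≥ 1} ∑_{m = 1}^{n - 1} 1 / (n ^ a * m ^ b)`, for integers
`a ≥ 2`, `b ≥ 1` (the series converges for these; the term `n = 0` is an empty sum). -/
noncomputable def doubleZeta (a b : ℕ) : ℝ :=
  ∑' n : ℕ, ∑ m ∈ Finset.Ico 1 n, 1 / ((n : ℝ) ^ a * (m : ℝ) ^ b)

/-- The complex plane cut along the real half-line `[1, ∞)`. -/
def cutPlane : Set ℂ := {z : ℂ | 1 - z ∈ Complex.slitPlane}

/-- `F` is an analytic continuation to `ℂ \ [1, ∞)` of the Gauss series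
`∑ₖ (a)ₖ (b)ₖ / ((c)ₖ k!) z ^ k`, `|z| < 1` (which is Mathlib's `ordinaryHypergeometric`). -/
def IsGaussContinuation (a b c : ℂ) (F : ℂ → ℂ) : Prop :=
  AnalyticOnNhd ℂ F cutPlane ∧ ∀ z : ℂ, ‖z‖ < 1 → F z = ordinaryHypergeometric a b c z

/-- The analytic continuation of the Gauss series to `ℂ \ [1, ∞)` is unique. -/
theorem IsGaussContinuation.eqOn {a b c : ℂ} {F G : ℂ → ℂ}
    (hF : IsGaussContinuation a b c F) (hG : IsGaussContinuation a b c G) :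
    Set.EqOn F G cutPlane := by
  have hpre : IsPreconnected cutPlane := by
    have h1 : IsPreconnected Complex.slitPlane :=
      (Complex.starConvex_one_slitPlane.isPathConnected
        Complex.one_mem_slitPlane).isConnected.isPreconnected
    have h2 : cutPlane = (fun w : ℂ => 1 - w) '' Complex.slitPlane := by
      ext z
      constructor
      · intro hz
        exact ⟨1 - z, hz, by ring⟩
      · rintro ⟨w, hw, rfl⟩
        simpa [cutPlane] using hw
    rw [h2]
    exact h1.image _ (by fun_prop)
  refine hF.1.eqOn_of_preconnected_of_eventuallyEq hG.1 hpre (z₀ := 0)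
    (by simp [cutPlane]) ?_
  filter_upwards [Metric.ball_mem_nhds (0 : ℂ) one_pos] with z hz
  have hz' : ‖z‖ < 1 := by simpa using hz
  rw [hF.2 z hz', hG.2 z hz']

/-- The Gaussian hypergeometric function `₂F₁(a, b; c; z)` on `ℂ \ [1, ∞)`: the analytic
continuation of the Gauss series. Meaningful whenever a continuation exists. -/
noncomputable def gaussHypergeometric (a b c : ℂ) : ℂ → ℂ :=
  Classical.epsilon (IsGaussContinuation a b c)

/-! Write `j = |n - 2k|`. The weight is `(n-1)!` times `w_k = C(n-1+j, n-1)`, which is invariant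
under `k ↦ n - k`. Averaging the sum with its reflection, the stuffle product replaces each double
zeta value by half of `ζ(2k)ζ(2n-2k) - ζ(2n)`. Two sums remain. By Euler's formula the products
reduce to a convolution of the coefficients of `(x/2) coth (x/2)` against `w_k`. The addition
formula of `coth` evaluates it as a multiple of the coefficient of index `2n` (`sq_evenBernoulli`,
`sum_evenBernoulli_mul_choose_natAbs`), hence of `ζ(2n)`. The sum of the `w_k` is, up to elementary
terms, an alternating sum of the `C(n+i, n)` (`sum_choose_natAbs`). The same sum gives the
hypergeometric value at `-1`, because the Gauss series is a tail of the binomial series of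
`(1-z)^(-n-1)` (`gaussHypergeometric_neg_one`). -/

/-! ### The hypergeometric function as a tail of a binomial series. -/

/-- The coefficients of `₂F₁(1, 2n+2; n+2; z)` are binomial coefficients up to a constant. -/
theorem choose_mul_gaussCoefficient (n k : ℕ) :
    ((2 * n + 1).choose n : ℂ) *
      ordinaryHypergeometricCoefficient (1 : ℂ) (2 * n + 2) (n + 2) k =
      ((n + (n + 1 + k)).choose n : ℂ) := by
  have h1 : (ascPochhammer ℂ k).eval 1 = (k.factorial : ℂ) := (Nat.cast_factorial ℂ k).symm
  have h2 : (ascPochhammer ℂ k).eval (2 * n + 2 : ℂ) = ((2 * n + 2).ascFactorial k : ℂ) := by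
    rw [← ascPochhammer_nat_eq_natCast_ascFactorial]; push_cast; rfl
  have h3 : (ascPochhammer ℂ k).eval (n + 2 : ℂ) = ((n + 2).ascFactorial k : ℂ) := by
    rw [← ascPochhammer_nat_eq_natCast_ascFactorial]; push_cast; rfl
  have h4 : ((2 * n + 1).factorial : ℂ) * ((2 * n + 2).ascFactorial k : ℂ) =
      ((2 * n + 1 + k).factorial : ℂ) := by
    exact_mod_cast Nat.factorial_mul_ascFactorial (2 * n + 1) k
  have h5 : ((n + 1).factorial : ℂ) * ((n + 2).ascFactorial k : ℂ) =
      ((n + 1 + k).factorial : ℂ) := by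
    exact_mod_cast Nat.factorial_mul_ascFactorial (n + 1) k
  have h6 : ((2 * n + 1).choose n : ℂ) * (n.factorial * (n + 1).factorial) =
      ((2 * n + 1).factorial : ℂ) := by
    have := Nat.add_choose_mul_factorial_mul_factorial n (n + 1)
    rw [← Nat.choose_symm_add] at this
    rw [← mul_assoc, show 2 * n + 1 = n + (n + 1) by ring]
    exact_mod_cast this
  have h7 : ((n + (n + 1 + k)).choose n : ℂ) * (n.factorial * (n + 1 + k).factorial) =
      ((2 * n + 1 + k).factorial : ℂ) := by
    have := Nat.add_choose_mul_factorial_mul_factorial n (n + 1 + k)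
    rw [← Nat.choose_symm_add] at this
    rw [← mul_assoc, show 2 * n + 1 + k = n + (n + 1 + k) by ring]
    exact_mod_cast this
  have e1 : (k.factorial : ℂ) ≠ 0 := by exact_mod_cast k.factorial_ne_zero
  have e2 : (n.factorial : ℂ) ≠ 0 := by exact_mod_cast n.factorial_ne_zero
  have e3 : ((n + 1).factorial : ℂ) ≠ 0 := by exact_mod_cast (n + 1).factorial_ne_zero
  have e5 : ((n + 1 + k).factorial : ℂ) ≠ 0 := by exact_mod_cast (n + 1 + k).factorial_ne_zero
  have e4 : ((n + 2).ascFactorial k : ℂ) ≠ 0 := by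
    intro h; rw [h, mul_zero] at h5; exact e5 h5.symm
  rw [ordinaryHypergeometricCoefficient, h1, h2, h3, inv_mul_cancel₀ e1, one_mul,
    ← div_eq_mul_inv, mul_div_assoc', div_eq_iff e4]
  apply mul_right_cancel₀ (mul_ne_zero e2 e3)
  calc _ = ((2 * n + 1).choose n : ℂ) * (n.factorial * (n + 1).factorial) *
        ((2 * n + 2).ascFactorial k : ℂ) := by ring
    _ = ((n + (n + 1 + k)).choose n : ℂ) * (n.factorial * (n + 1 + k).factorial) := by
        rw [h6, h7, h4]
    _ = _ := by rw [← h5]; ring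

theorem choose_mul_gaussSeries (n : ℕ) {z : ℂ} (hz : ‖z‖ < 1) :
    ((2 * n + 1).choose n : ℂ) * ordinaryHypergeometric (1 : ℂ) (2 * n + 2) (n + 2) z *
      z ^ (n + 1) =
      ((1 - z) ^ (n + 1))⁻¹ - ∑ i ∈ Finset.range (n + 1), ((n + i).choose n : ℂ) * z ^ i := by
  have hs := hasSum_choose_mul_geometric_of_norm_lt_one n hz
  have h := hs.summable.sum_add_tsum_nat_add (n + 1)
  rw [hs.tsum_eq, one_div] at h
  rw [← h, ordinaryHypergeometric_eq_tsum]
  simp only [smul_eq_mul]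
  rw [← tsum_mul_left, ← tsum_mul_right]
  simp only [add_comm _ n]
  rw [add_sub_cancel_left]
  refine tsum_congr fun k => ?_
  have := choose_mul_gaussCoefficient n k
  rw [ordinaryHypergeometricCoefficient] at this
  rw [← mul_assoc, this, add_comm k (n + 1), pow_add]
  ring

/-- An explicit analytic continuation of `₂F₁(1, 2n+2; n+2; z)`. -/
noncomputable def rationalGaussContinuation (n : ℕ) (z : ℂ) : ℂ :=
  open Classical in
  if ‖z‖ < 1 then ordinaryHypergeometric (1 : ℂ) (2 * n + 2) (n + 2) z
  else (((1 - z) ^ (n + 1))⁻¹ - ∑ i ∈ Finset.range (n + 1), ((n + i).choose n : ℂ) * z ^ i) /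
    (((2 * n + 1).choose n : ℂ) * z ^ (n + 1))

/-- The series branch of the definition matters only at the removable singularity `z = 0`, where the
quotient evaluates to `0` instead of `1`. -/
theorem rationalGaussContinuation_of_ne_zero (n : ℕ) {z : ℂ} (hz : z ≠ 0) :
    rationalGaussContinuation n z =
      (((1 - z) ^ (n + 1))⁻¹ - ∑ i ∈ Finset.range (n + 1), ((n + i).choose n : ℂ) * z ^ i) /
        (((2 * n + 1).choose n : ℂ) * z ^ (n + 1)) := by
  have hc : ((2 * n + 1).choose n : ℂ) ≠ 0 := by
    exact_mod_cast (Nat.choose_pos (by omega)).ne'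
  unfold rationalGaussContinuation
  split_ifs with h
  · rw [eq_div_iff (mul_ne_zero hc (pow_ne_zero _ hz)), ← choose_mul_gaussSeries n h]
    ring
  · rfl

theorem isGaussContinuation_rationalGaussContinuation (n : ℕ) :
    IsGaussContinuation 1 (2 * n + 2) (n + 2) (rationalGaussContinuation n) := by
  refine ⟨fun z hz => ?_, fun z hz => by simp [rationalGaussContinuation, hz]⟩
  by_cases h0 : z = 0
  · subst h0
    have hr : (ordinaryHypergeometricSeries ℂ (1 : ℂ) (2 * n + 2) (n + 2)).radius = 1 := by
      refine ordinaryHypergeometricSeries_radius_eq_one ℂ _ _ _ fun k => ⟨?_, ?_, ?_⟩ <;>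
      · intro h
        have := congrArg Complex.re h
        simp at this
        linarith [(Nat.cast_nonneg k : (0 : ℝ) ≤ k), (Nat.cast_nonneg n : (0 : ℝ) ≤ n)]
    have h := ((ordinaryHypergeometricSeries ℂ (1 : ℂ) (2 * n + 2) (n + 2)).hasFPowerSeriesOnBall
      (by rw [hr]; exact one_pos)).analyticAt
    refine h.congr ?_
    filter_upwards [Metric.ball_mem_nhds (0 : ℂ) one_pos] with z hz
    have hz' : ‖z‖ < 1 := by simpa using hz
    simp [rationalGaussContinuation, hz', ordinaryHypergeometric]
  · have h1 : 1 - z ≠ 0 := Complex.slitPlane_ne_zero hz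
    have hc : ((2 * n + 1).choose n : ℂ) ≠ 0 := by
      exact_mod_cast (Nat.choose_pos (by omega)).ne'
    have h : AnalyticAt ℂ (fun z : ℂ => (((1 - z) ^ (n + 1))⁻¹ -
        ∑ i ∈ Finset.range (n + 1), ((n + i).choose n : ℂ) * z ^ i) /
        (((2 * n + 1).choose n : ℂ) * z ^ (n + 1))) z := by
      refine AnalyticAt.div (AnalyticAt.sub (AnalyticAt.inv (by fun_prop) (pow_ne_zero _ h1)) ?_)
        (by fun_prop) (mul_ne_zero hc (pow_ne_zero _ h0))
      exact Finset.analyticAt_fun_sum _ fun i _ => by fun_prop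
    refine h.congr ?_
    filter_upwards [isOpen_ne.mem_nhds h0] with w hw
    rw [rationalGaussContinuation_of_ne_zero n hw]

theorem isGaussContinuation_gaussHypergeometric (n : ℕ) :
    IsGaussContinuation 1 (2 * n + 2) (n + 2) (gaussHypergeometric 1 (2 * n + 2) (n + 2)) :=
  Classical.epsilon_spec ⟨_, isGaussContinuation_rationalGaussContinuation n⟩

theorem gaussHypergeometric_neg_one (n : ℕ) :
    ((2 * n + 1).choose n : ℂ) * gaussHypergeometric 1 (2 * n + 2) (n + 2) (-1) =
      (-1) ^ n * (∑ i ∈ Finset.range (n + 1), ((n + i).choose n : ℂ) * (-1) ^ i) -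
        (-1) ^ n / 2 ^ (n + 1) := by
  have hc : ((2 * n + 1).choose n : ℂ) ≠ 0 := by
    exact_mod_cast (Nat.choose_pos (by omega)).ne'
  have hm : (-1 : ℂ) ∈ cutPlane := by
    simp only [cutPlane, Set.mem_ofPred_eq]
    left; norm_num
  rw [(isGaussContinuation_gaussHypergeometric n).eqOn
    (isGaussContinuation_rationalGaussContinuation n) hm,
    rationalGaussContinuation_of_ne_zero n (by norm_num)]
  have h1 : ((-1 : ℂ) ^ (n + 1)) * (-1) ^ (n + 1) = 1 := by rw [← mul_pow]; norm_num
  have h2 : ((-1 : ℂ) ^ (n + 1)) ≠ 0 := pow_ne_zero _ (by norm_num)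
  have h3 : ((-1 : ℂ) ^ (n + 1))⁻¹ = (-1) ^ (n + 1) := inv_eq_of_mul_eq_one_left h1
  rw [← div_div, div_eq_mul_inv _ ((-1 : ℂ) ^ (n + 1)), h3]
  field_simp
  norm_num
  ring

/-! ### Convolutions of Bernoulli numbers from the addition formula of `coth`. -/

/-- The power series `(x / 2) coth (x / 2)`. -/
noncomputable def evenBernoulliSeries : PowerSeries ℚ :=
  bernoulliPowerSeries ℚ + PowerSeries.C (1 / 2) * PowerSeries.X

/-- The coefficients of `(x / 2) coth (x / 2)`. -/
noncomputable def evenBernoulli (m : ℕ) : ℚ := PowerSeries.coeff m evenBernoulliSeries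

theorem evenBernoulli_of_ne_one {m : ℕ} (hm : m ≠ 1) :
    evenBernoulli m = bernoulli m / m.factorial := by
  simp [evenBernoulli, evenBernoulliSeries, bernoulliPowerSeries, PowerSeries.coeff_X, hm]

theorem evenBernoulli_zero : evenBernoulli 0 = 1 := by
  simp [evenBernoulli_of_ne_one]

theorem evenBernoulli_of_odd {m : ℕ} (hm : Odd m) : evenBernoulli m = 0 := by
  rcases eq_or_ne m 1 with rfl | h
  · simp [evenBernoulli, evenBernoulliSeries, bernoulliPowerSeries, bernoulli_one]
    norm_num
  · rw [evenBernoulli_of_ne_one h, bernoulli_eq_zero_of_odd hm (by have := hm.pos; omega), zero_div]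

open PowerSeries in
theorem rescale_evenBernoulliSeries_mul (a : ℚ) :
    2 * rescale a evenBernoulliSeries * (rescale a (exp ℚ) - 1) =
      C a * X * (rescale a (exp ℚ) + 1) := by
  have h := congrArg (rescale a) (bernoulliPowerSeries_mul_exp_sub_one ℚ)
  have h2 : (2 : PowerSeries ℚ) * C (1 / 2) = 1 := by
    rw [show (2 : PowerSeries ℚ) = C 2 from (map_ofNat C 2).symm, ← map_mul]; norm_num
  have h3 : rescale a (C (1 / 2 : ℚ)) = C (1 / 2) := by
    ext n; rcases n with _ | n <;> simp [coeff_rescale, coeff_C]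
  simp only [map_mul, map_sub, map_one, rescale_X] at h
  simp only [evenBernoulliSeries, map_add, map_mul, rescale_X, h3]
  linear_combination 2 * h + C a * X * (rescale a (exp ℚ) - 1) * h2

open PowerSeries in
theorem rescale_exp_sub_one_ne_zero {a : ℚ} (ha : a ≠ 0) : rescale a (exp ℚ) - 1 ≠ 0 := by
  intro h
  have := congrArg (coeff 1) h
  simp [coeff_rescale, coeff_exp, coeff_one] at this
  exact ha this

open PowerSeries in
/-- The addition formula of `coth`, cleared of denominators. -/
theorem evenBernoulliSeries_addition {a b : ℚ} (ha : a ≠ 0) (hb : b ≠ 0) (hab : a + b ≠ 0) :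
    (C a + C b) * rescale a evenBernoulliSeries * rescale b evenBernoulliSeries +
      C (1 / 4) * C a * C b * (C a + C b) * X ^ 2 =
    rescale (a + b) evenBernoulliSeries *
      (C b * rescale a evenBernoulliSeries + C a * rescale b evenBernoulliSeries) := by
  have h4 : (4 : PowerSeries ℚ) * C (1 / 4) = 1 := by
    rw [show (4 : PowerSeries ℚ) = C 4 from (map_ofNat C 4).symm, ← map_mul]; norm_num
  have e1 := rescale_exp_sub_one_ne_zero ha
  have e2 := rescale_exp_sub_one_ne_zero hb
  have e3 := rescale_exp_sub_one_ne_zero hab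
  have f1 := rescale_evenBernoulliSeries_mul a
  have f2 := rescale_evenBernoulliSeries_mul b
  have f3 := rescale_evenBernoulliSeries_mul (a + b)
  rw [← exp_mul_exp_eq_exp_add] at e3 f3
  rw [map_add] at f3
  set E := rescale a (exp ℚ)
  set D := rescale b (exp ℚ)
  set G := rescale a evenBernoulliSeries
  set H := rescale b evenBernoulliSeries
  set K := rescale (a + b) evenBernoulliSeries
  have e4 : (4 : PowerSeries ℚ) ≠ 0 := by
    intro h; rw [h, zero_mul] at h4; exact zero_ne_one h4
  -- After multiplication by these nonzero factors, `f1`, `f2`, `f3` eliminate the three Bernoulli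
  -- series, leaving a polynomial identity in `E` and `D`.
  apply mul_left_cancel₀ (mul_ne_zero e4 (mul_ne_zero e1 (mul_ne_zero e2 e3)))
  linear_combination (E - 1) * (D - 1) * (E * D - 1) * C a * C b * (C a + C b) * X ^ 2 * h4 +
    (C a + C b) * (E * D - 1) * 2 * H * (D - 1) * f1 +
    (C a + C b) * (E * D - 1) * C a * X * (E + 1) * f2 -
    (2 * C b * G + 2 * C a * H) * (E - 1) * (D - 1) * f3 -
    C b * (D - 1) * (C a + C b) * X * (E * D + 1) * f1 -
    C a * (E - 1) * (C a + C b) * X * (E * D + 1) * f2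

-- Coefficient of `X ^ (2n)` in the addition formula with `b = 1`; for `n ≥ 2` the `X ^ 2` term does
-- not contribute.
open Finset in
theorem sum_evenBernoulli_eval {n : ℕ} (hn : 2 ≤ n) {a : ℚ} (ha : a ≠ 0) (ha1 : a + 1 ≠ 0) :
    (a + 1) * ∑ r ∈ range (2 * n + 1), evenBernoulli r * evenBernoulli (2 * n - r) * a ^ r =
      ∑ r ∈ range (2 * n + 1), evenBernoulli r * evenBernoulli (2 * n - r) *
        ((a + 1) ^ (2 * n - r) * (a ^ r + a)) := by
  have h := congrArg (PowerSeries.coeff (2 * n))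
    (evenBernoulliSeries_addition ha one_ne_zero ha1)
  have hX : PowerSeries.coeff (2 * n) (PowerSeries.C (1 / 4 : ℚ) * PowerSeries.C a *
      PowerSeries.C 1 * (PowerSeries.C a + PowerSeries.C 1) * PowerSeries.X ^ 2) = 0 := by
    simp only [← map_mul, ← map_add]
    rw [PowerSeries.coeff_C_mul, PowerSeries.coeff_X_pow, if_neg (by omega), mul_zero]
  rw [map_add, hX, add_zero, ← map_add, mul_assoc, PowerSeries.coeff_C_mul, mul_comm
    (PowerSeries.rescale (a + 1) _), PowerSeries.coeff_mul, PowerSeries.coeff_mul,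
    Nat.sum_antidiagonal_eq_sum_range_succ_mk, Nat.sum_antidiagonal_eq_sum_range_succ_mk] at h
  simp only [PowerSeries.coeff_rescale, map_add, PowerSeries.coeff_C_mul, one_pow, one_mul] at h
  convert h using 2
  · refine sum_congr rfl fun r _ => ?_
    simp only [evenBernoulli]; ring
  · simp only [evenBernoulli]; ring

-- Dividing the previous identity by `a + 1` makes it a polynomial identity in `a`, whose
-- coefficient at `a ^ n` is the claim. In the term `r = 2n` the division works because `a ^ (2n) +
-- a = a (1 + a ^ (2n-1))` with `2n - 1` odd.
open Finset Polynomial in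
theorem sq_evenBernoulli {n : ℕ} (hn : 2 ≤ n) :
    evenBernoulli n ^ 2 = 2 * ∑ r ∈ range (2 * n), evenBernoulli r * evenBernoulli (2 * n - r) *
      ((2 * n - r - 1).choose (n - 1) : ℚ) + (-1) ^ (n - 1) * evenBernoulli (2 * n) := by
  have key : (∑ r ∈ range (2 * n + 1), C (evenBernoulli r * evenBernoulli (2 * n - r)) * X ^ r :
      ℚ[X]) = ∑ r ∈ range (2 * n), C (evenBernoulli r * evenBernoulli (2 * n - r)) *
        ((X + 1) ^ (2 * n - r - 1) * X ^ r + (X + 1) ^ (2 * n - r - 1) * X ^ 1) +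
        C (evenBernoulli (2 * n)) * ∑ i ∈ range (2 * n - 1), C ((-1) ^ i) * X ^ (i + 1) := by
    apply eq_of_infinite_eval_eq
    refine ((Set.finite_singleton (-1 : ℚ)).insert 0).infinite_compl.mono fun a ha => ?_
    simp only [Set.mem_compl_iff, Set.mem_insert_iff, Set.mem_singleton_iff, not_or] at ha
    obtain ⟨ha0, ha1⟩ := ha
    have ha1 : a + 1 ≠ 0 := fun h => ha1 (by linarith)
    have h := sum_evenBernoulli_eval hn ha0 ha1
    simp only [Set.mem_ofPred_eq, eval_finsetSum, eval_add, eval_mul, eval_C, eval_pow, eval_X,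
      eval_one]
    apply mul_left_cancel₀ ha1
    rw [h, sum_range_succ, mul_add (a + 1), mul_sum (range (2 * n))]
    congr 1
    · refine sum_congr rfl fun r hr => ?_
      obtain ⟨m, hm⟩ : ∃ m, 2 * n - r = m + 1 := ⟨2 * n - r - 1, by have := mem_range.1 hr; omega⟩
      rw [hm, Nat.add_sub_cancel]
      ring
    · have hg := mul_neg_geom_sum (-a) (2 * n - 1)
      have e : ∑ i ∈ range (2 * n - 1), (-1) ^ i * a ^ (i + 1) =
          a * ∑ i ∈ range (2 * n - 1), (-a) ^ i := by
        rw [mul_sum]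
        exact sum_congr rfl fun i _ => by rw [neg_pow a]; ring
      have ho : Odd (2 * n - 1) := ⟨n - 1, by omega⟩
      rw [ho.neg_pow] at hg
      have hp : a ^ (2 * n) = a * a ^ (2 * n - 1) := by
        rw [← pow_succ']; congr 1; omega
      rw [e, Nat.sub_self, evenBernoulli_zero, pow_zero, hp]
      linear_combination -(evenBernoulli (2 * n) * a) * hg
  have h := congrArg (fun p => coeff p n) key
  simp only [finsetSum_coeff, coeff_add, coeff_C_mul] at h
  simp only [coeff_X_pow, coeff_mul_X_pow', coeff_X_add_one_pow] at h
  have e : ∑ i ∈ range (2 * n - 1), (-1 : ℚ) ^ i * (if n = i + 1 then 1 else 0) =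
      (-1) ^ (n - 1) := by
    rw [sum_eq_single (n - 1) (by intro r _ hr; rw [if_neg (by omega), mul_zero])
      (by intro h; exact absurd (mem_range.2 (by omega)) h), if_pos (by omega), mul_one]
  rw [sum_eq_single n (by intro r _ hr; simp [hr.symm])
    (by intro h; exact absurd (mem_range.2 (by omega)) h), e, if_pos rfl,
    show 2 * n - n = n by omega, mul_one, ← pow_two] at h
  rw [h, mul_sum, mul_comm (evenBernoulli (2 * n))]
  congr 1
  refine sum_congr rfl fun r hr => ?_
  have hr := mem_range.1 hr
  rw [if_pos (show 1 ≤ n by omega)]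
  split_ifs with hrn
  -- The two powers of `X + 1` contribute complementary, hence equal, binomials; this is the factor
  -- `2`.
  · rw [← Nat.choose_symm_of_eq_add (show 2 * n - r - 1 = (n - r) + (n - 1) by omega)]
    ring
  · rw [Nat.choose_eq_zero_of_lt (by omega : 2 * n - r - 1 < n - 1)]
    simp

-- Odd indices vanish, and `r = 0` yields the binomial on the right.
open Finset in
theorem sum_evenBernoulli_mul_choose {n : ℕ} (hn : 2 ≤ n) :
    2 * ∑ k ∈ Ico 1 n, evenBernoulli (2 * k) * evenBernoulli (2 * n - 2 * k) *
      ((2 * n - 2 * k - 1).choose (n - 1) : ℚ) - evenBernoulli n ^ 2 =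
    -(2 * ((2 * n - 1).choose (n - 1) : ℚ) + (-1) ^ (n - 1)) * evenBernoulli (2 * n) := by
  have h := sq_evenBernoulli hn
  have par : ∀ (f : ℕ → ℚ) (m : ℕ), (∀ k, f (2 * k + 1) = 0) →
      ∑ r ∈ range (2 * m), f r = ∑ k ∈ range m, f (2 * k) := by
    intro f m hf
    induction m with
    | zero => simp
    | succ m ih => rw [Nat.mul_succ, sum_range_succ, sum_range_succ, ih, hf, sum_range_succ,
        add_zero]
  rw [par _ _ fun k => by rw [evenBernoulli_of_odd ⟨k, rfl⟩]; simp, range_eq_Ico,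
    sum_eq_sum_Ico_succ_bot (by omega)] at h
  rw [h]
  simp only [mul_zero, evenBernoulli_zero, Nat.sub_zero, zero_add]
  ring

/-! ### Sums of the binomial weights. -/

-- By Pascal's rule `C(2k-1, n-1) = C(2k, n) - C(2k-1, n)`.
open Finset in
theorem sum_choose_odd {n : ℕ} (hn : 1 ≤ n) (m : ℕ) :
    ∑ k ∈ Ico 1 (m + 1), ((2 * k - 1).choose (n - 1) : ℤ) =
      ∑ i ∈ range (2 * m + 1), (-1) ^ i * (i.choose n : ℤ) := by
  induction m with
  | zero => simp [Nat.choose_eq_zero_of_lt hn]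
  | succ m ih =>
    rw [sum_Ico_succ_top (by omega), ih, show 2 * (m + 1) + 1 = 2 * m + 1 + 1 + 1 by ring,
      sum_range_succ _ (2 * m + 1 + 1), sum_range_succ _ (2 * m + 1)]
    obtain ⟨p, rfl⟩ : ∃ p, n = p + 1 := ⟨n - 1, by omega⟩
    rw [Nat.choose_succ_succ (2 * m + 1) p, show 2 * (m + 1) - 1 = 2 * m + 1 by omega,
      Nat.add_sub_cancel, pow_succ _ (2 * m + 1), pow_succ _ (2 * m), pow_mul]
    push_cast
    ring

open Finset in
theorem sum_choose_odd_eq_alternating {n : ℕ} (hn : 1 ≤ n) :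
    ∑ k ∈ Ico 1 (n + 1), ((2 * k - 1).choose (n - 1) : ℤ) =
      (-1) ^ n * ∑ i ∈ range (n + 1), ((n + i).choose n : ℤ) * (-1) ^ i := by
  rw [sum_choose_odd hn, show 2 * n + 1 = n + (n + 1) by ring, sum_range_add,
    sum_eq_zero fun i hi => by
      rw [Nat.choose_eq_zero_of_lt (mem_range.1 hi), Nat.cast_zero, mul_zero], zero_add, mul_sum]
  exact sum_congr rfl fun i _ => by rw [pow_add]; ring

/-- The upper index on the left is `max (2k) (2n-2k) - 1`. Off the diagonal `2k = n` the other
binomial on the right vanishes; on it both equal `1`, which the indicator corrects. -/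
theorem choose_natAbs_add {n k : ℕ} (hk : 1 ≤ k) (hkn : k < n) :
    (n - 1 + ((n : ℤ) - 2 * k).natAbs).choose (n - 1) + (if 2 * k = n then 1 else 0) =
      (2 * k - 1).choose (n - 1) + (2 * n - 2 * k - 1).choose (n - 1) := by
  rcases lt_trichotomy (2 * k) n with h | h | h
  · rw [if_neg h.ne, Nat.choose_eq_zero_of_lt (by omega : 2 * k - 1 < n - 1),
      show n - 1 + ((n : ℤ) - 2 * k).natAbs = 2 * n - 2 * k - 1 by omega]
    ring
  · rw [if_pos h, show n - 1 + ((n : ℤ) - 2 * k).natAbs = n - 1 by omega,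
      show 2 * k - 1 = n - 1 by omega, show 2 * n - 2 * k - 1 = n - 1 by omega]
    simp
  · rw [if_neg h.ne', Nat.choose_eq_zero_of_lt (by omega : 2 * n - 2 * k - 1 < n - 1),
      show n - 1 + ((n : ℤ) - 2 * k).natAbs = 2 * k - 1 by omega]

open Finset in
theorem sum_Ico_reflect_self {M : Type*} [AddCommMonoid M] (f : ℕ → M) (n : ℕ) :
    ∑ k ∈ Ico 1 n, f (n - k) = ∑ k ∈ Ico 1 n, f k := by
  refine sum_nbij' (fun k => n - k) (fun k => n - k) ?_ ?_ ?_ ?_ fun _ _ => rfl <;>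
    intro k hk <;> simp only [mem_Ico] at hk ⊢ <;> omega

open Finset in
/-- Sums of even-indexed symmetric terms against the weight `C(n - 1 + |n - 2k|, n - 1)`. -/
theorem sum_mul_choose_natAbs {n : ℕ} (f : ℕ → ℚ) (hf : ∀ k ∈ Ico 1 n, f (n - k) = f k) :
    ∑ k ∈ Ico 1 n, f k * ((n - 1 + ((n : ℤ) - 2 * k).natAbs).choose (n - 1) : ℚ) =
      2 * ∑ k ∈ Ico 1 n, f k * ((2 * n - 2 * k - 1).choose (n - 1) : ℚ) -
        ∑ k ∈ Ico 1 n, if 2 * k = n then f k else 0 := by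
  have h1 : ∑ k ∈ Ico 1 n, f k * ((2 * k - 1).choose (n - 1) : ℚ) =
      ∑ k ∈ Ico 1 n, f k * ((2 * n - 2 * k - 1).choose (n - 1) : ℚ) := by
    rw [← sum_Ico_reflect_self]
    refine sum_congr rfl fun k hk => ?_
    rw [hf k hk, Nat.mul_sub]
  rw [two_mul]
  nth_rw 1 [← h1]
  rw [← sum_add_distrib, ← sum_sub_distrib]
  refine sum_congr rfl fun k hk => ?_
  obtain ⟨hk1, hk2⟩ := mem_Ico.1 hk
  have h := choose_natAbs_add hk1 hk2
  have h' : ((n - 1 + ((n : ℤ) - 2 * k).natAbs).choose (n - 1) : ℚ) +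
      (if 2 * k = n then 1 else 0) =
      ((2 * k - 1).choose (n - 1) : ℚ) + ((2 * n - 2 * k - 1).choose (n - 1) : ℚ) := by
    exact_mod_cast h
  rw [← mul_add, ← h']
  split_ifs <;> ring

open Finset in
theorem sum_evenBernoulli_mul_choose_natAbs {n : ℕ} (hn : 2 ≤ n) :
    ∑ k ∈ Ico 1 n, evenBernoulli (2 * k) * evenBernoulli (2 * n - 2 * k) *
      ((n - 1 + ((n : ℤ) - 2 * k).natAbs).choose (n - 1) : ℚ) =
    -(2 * ((2 * n - 1).choose (n - 1) : ℚ) - (-1) ^ n) * evenBernoulli (2 * n) := by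
  rw [sum_mul_choose_natAbs (fun k => evenBernoulli (2 * k) * evenBernoulli (2 * n - 2 * k))]
  · have e : (-1 : ℚ) ^ n = -(-1) ^ (n - 1) := by
      obtain ⟨p, rfl⟩ : ∃ p, n = p + 1 := ⟨n - 1, by omega⟩
      rw [pow_succ]; simp
    rw [e, sub_neg_eq_add, ← sum_evenBernoulli_mul_choose hn]
    congr 1
    -- The diagonal term is `evenBernoulli n ^ 2` for even `n`; for odd `n` there is no such term
    -- and `evenBernoulli n = 0`.
    rcases Nat.even_or_odd' n with ⟨m, rfl | rfl⟩
    · rw [sum_eq_single m]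
      · rw [if_pos rfl, show 2 * (2 * m) - 2 * m = 2 * m by omega, pow_two]
      · intro k _ hk; rw [if_neg (by omega)]
      · intro h; exact absurd (mem_Ico.2 (by omega)) h
    · rw [evenBernoulli_of_odd ⟨m, rfl⟩, sum_eq_zero fun k _ => if_neg (by omega)]
      norm_num
  · intro k hk
    have := mem_Ico.1 hk
    rw [show 2 * (n - k) = 2 * n - 2 * k by omega,
      show 2 * n - (2 * n - 2 * k) = 2 * k by omega, mul_comm]

open Finset in
theorem sum_choose_natAbs {n : ℕ} (hn : 2 ≤ n) :
    ∑ k ∈ Ico 1 n, ((n - 1 + ((n : ℤ) - 2 * k).natAbs).choose (n - 1) : ℚ) =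
      2 * ((-1) ^ n * ∑ i ∈ range (n + 1), ((n + i).choose n : ℚ) * (-1) ^ i) -
        2 * ((2 * n - 1).choose (n - 1) : ℚ) - (1 + (-1) ^ n) / 2 := by
  have h := sum_mul_choose_natAbs (n := n) (fun _ => 1) (fun _ _ => rfl)
  simp only [one_mul] at h
  have hr := sum_Ico_reflect_self (fun k => ((2 * k - 1).choose (n - 1) : ℚ)) n
  simp only [Nat.mul_sub] at hr
  have ha : ∑ k ∈ Ico 1 (n + 1), ((2 * k - 1).choose (n - 1) : ℚ) =
      (-1) ^ n * ∑ i ∈ range (n + 1), ((n + i).choose n : ℚ) * (-1) ^ i := by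
    exact_mod_cast congrArg (Int.cast : ℤ → ℚ) (sum_choose_odd_eq_alternating (n := n) (by omega))
  -- The extra term `k = n` accounts for `C(2n-1, n-1)` in the result.
  rw [sum_Ico_succ_top (by omega)] at ha
  have hp : (∑ k ∈ Ico 1 n, if 2 * k = n then (1 : ℚ) else 0) = (1 + (-1) ^ n) / 2 := by
    rcases Nat.even_or_odd' n with ⟨m, rfl | rfl⟩
    · rw [sum_eq_single m]
      · rw [if_pos rfl, pow_mul]; norm_num
      · intro k _ hk; rw [if_neg (by omega)]
      · intro h; exact absurd (mem_Ico.2 (by omega)) h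
    · rw [sum_eq_zero fun k _ => if_neg (by omega), pow_succ, pow_mul]
      norm_num
  rw [h, hr, hp, ← ha]
  ring

/-! ### Double zeta values and the stuffle product. -/

open Finset in
theorem hasSum_doubleZeta {a b : ℕ} (ha : 2 ≤ a) (hb : 2 ≤ b) :
    HasSum (fun n : ℕ => 1 / (n : ℝ) ^ a * ∑ m ∈ range n, 1 / (m : ℝ) ^ b) (doubleZeta a b) := by
  have hsa := Real.summable_one_div_nat_pow.2 (show 1 < a by omega)
  have hsb := Real.summable_one_div_nat_pow.2 (show 1 < b by omega)
  have hs : Summable (fun n : ℕ => 1 / (n : ℝ) ^ a * ∑ m ∈ range n, 1 / (m : ℝ) ^ b) := by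
    refine Summable.of_nonneg_of_le (fun n => by positivity) (fun n => ?_)
      (hsa.mul_right (∑' m : ℕ, 1 / (m : ℝ) ^ b))
    exact mul_le_mul_of_nonneg_left (hsb.sum_le_tsum _ fun _ _ => by positivity) (by positivity)
  convert hs.hasSum using 1
  refine tsum_congr fun n => ?_
  rw [mul_sum]
  rcases n with _ | n
  · simp
  -- The added index `m = 0` contributes `1 / 0 = 0`.
  · rw [range_eq_Ico, sum_eq_sum_Ico_succ_bot n.succ_pos]
    rw [Nat.cast_zero, zero_pow (by omega), div_zero, mul_zero, zero_add]
    exact sum_congr rfl fun m _ => by rw [one_div_mul_one_div]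

open Finset in
/-- The stuffle product of two zeta values. -/
theorem doubleZeta_add_doubleZeta {a b : ℕ} (ha : 2 ≤ a) (hb : 2 ≤ b) :
    doubleZeta a b + doubleZeta b a + ∑' n : ℕ, 1 / (n : ℝ) ^ (a + b) =
      (∑' n : ℕ, 1 / (n : ℝ) ^ a) * ∑' n : ℕ, 1 / (n : ℝ) ^ b := by
  have hsa := Real.summable_one_div_nat_pow.2 (show 1 < a by omega)
  have hsb := Real.summable_one_div_nat_pow.2 (show 1 < b by omega)
  have hsc := Real.summable_one_div_nat_pow.2 (show 1 < a + b by omega)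
  have h1 := (((hasSum_doubleZeta ha hb).add (hasSum_doubleZeta hb ha)).add
    hsc.hasSum).tendsto_sum_nat
  refine tendsto_nhds_unique h1
    ((hsa.hasSum.tendsto_sum_nat.mul hsb.hasSum.tendsto_sum_nat).congr fun N => ?_)
  -- The identity already holds for partial sums: a square of index pairs splits into two triangles
  -- and the diagonal.
  induction N with
  | zero => simp
  | succ N ih =>
    rw [sum_range_succ _ N, sum_range_succ _ N, sum_range_succ _ N, ← ih, pow_add,
      ← one_div_mul_one_div]
    ring

theorem tsum_one_div_pow_two_mul {k : ℕ} (hk : k ≠ 0) :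
    ∑' n : ℕ, 1 / (n : ℝ) ^ (2 * k) =
      (-1) ^ (k + 1) * 2 ^ (2 * k - 1) * Real.pi ^ (2 * k) * (evenBernoulli (2 * k) : ℝ) := by
  rw [(hasSum_zeta_nat hk).tsum_eq, evenBernoulli_of_ne_one (by omega)]
  push_cast
  ring

open Finset in
theorem sum_choose_natAbs_mul_doubleZeta {n : ℕ} (hn : 2 ≤ n) :
    ∑ k ∈ Ico 1 n, ((n - 1 + ((n : ℤ) - 2 * k).natAbs).choose (n - 1) : ℝ) *
      doubleZeta (2 * k) (2 * n - 2 * k) =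
    ((2 * n - 1).choose (n - 1) - (-1) ^ n / 2 -
      ∑ k ∈ Ico 1 n, ((n - 1 + ((n : ℤ) - 2 * k).natAbs).choose (n - 1) : ℝ)) / 2 *
      ∑' m : ℕ, 1 / (m : ℝ) ^ (2 * n) := by
  set w : ℕ → ℝ := fun k => ((n - 1 + ((n : ℤ) - 2 * k).natAbs).choose (n - 1) : ℝ) with hw
  change ∑ k ∈ Ico 1 n, w k * doubleZeta (2 * k) (2 * n - 2 * k) =
    ((2 * n - 1).choose (n - 1) - (-1) ^ n / 2 - ∑ k ∈ Ico 1 n, w k) / 2 *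
      ∑' m : ℕ, 1 / (m : ℝ) ^ (2 * n)
  have hrefl : ∑ k ∈ Ico 1 n, w k * doubleZeta (2 * k) (2 * n - 2 * k) =
      ∑ k ∈ Ico 1 n, w k * doubleZeta (2 * n - 2 * k) (2 * k) := by
    rw [← sum_Ico_reflect_self]
    refine sum_congr rfl fun k hk => ?_
    have := mem_Ico.1 hk
    have e : ((n : ℤ) - 2 * (n - k : ℕ)).natAbs = ((n : ℤ) - 2 * k).natAbs := by omega
    simp only [hw]
    rw [e, show 2 * (n - k) = 2 * n - 2 * k by omega,
      show 2 * n - (2 * n - 2 * k) = 2 * k by omega]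
  have hb : ∑ k ∈ Ico 1 n, (evenBernoulli (2 * k) : ℝ) * (evenBernoulli (2 * n - 2 * k) : ℝ) * w k =
      -(2 * ((2 * n - 1).choose (n - 1) : ℝ) - (-1) ^ n) * (evenBernoulli (2 * n) : ℝ) := by
    simp only [hw]
    exact_mod_cast congrArg (Rat.cast : ℚ → ℝ) (sum_evenBernoulli_mul_choose_natAbs hn)
  have hterm : ∀ k ∈ Ico 1 n, w k * doubleZeta (2 * k) (2 * n - 2 * k) +
      w k * doubleZeta (2 * n - 2 * k) (2 * k) =
      (-1) ^ n * 2 ^ (2 * n - 2) * Real.pi ^ (2 * n) *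
        ((evenBernoulli (2 * k) : ℝ) * (evenBernoulli (2 * n - 2 * k) : ℝ) * w k) -
      w k * ∑' m : ℕ, 1 / (m : ℝ) ^ (2 * n) := by
    intro k hk
    obtain ⟨hk1, hk2⟩ := mem_Ico.1 hk
    have h := doubleZeta_add_doubleZeta (a := 2 * k) (b := 2 * n - 2 * k) (by omega) (by omega)
    have e : 2 * n - 2 * k = 2 * (n - k) := by omega
    rw [show 2 * k + (2 * n - 2 * k) = 2 * n by omega, tsum_one_div_pow_two_mul (by omega : k ≠ 0),
      e, tsum_one_div_pow_two_mul (by omega : n - k ≠ 0)] at h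
    rw [e]
    -- This removes the truncated subtractions from the exponents of `2`.
    obtain ⟨p, rfl⟩ : ∃ p, k = p + 1 := ⟨k - 1, by omega⟩
    obtain ⟨q, rfl⟩ : ∃ q, n = p + 1 + (q + 1) := ⟨n - p - 2, by omega⟩
    rw [Nat.add_sub_cancel_left] at h ⊢
    rw [show 2 * (p + 1 + (q + 1)) - 2 = (2 * p + 1) + (2 * q + 1) by omega]
    rw [show 2 * (p + 1) - 1 = 2 * p + 1 by omega, show 2 * (q + 1) - 1 = 2 * q + 1 by omega] at h
    rw [← mul_add, eq_sub_of_add_eq h]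
    ring
  have h2 : 2 * ∑ k ∈ Ico 1 n, w k * doubleZeta (2 * k) (2 * n - 2 * k) =
      (-1) ^ n * 2 ^ (2 * n - 2) * Real.pi ^ (2 * n) *
        (-(2 * ((2 * n - 1).choose (n - 1) : ℝ) - (-1) ^ n) * (evenBernoulli (2 * n) : ℝ)) -
      (∑ k ∈ Ico 1 n, w k) * ∑' m : ℕ, 1 / (m : ℝ) ^ (2 * n) := by
    rw [two_mul]
    nth_rw 2 [hrefl]
    rw [← sum_add_distrib, sum_congr rfl hterm, sum_sub_distrib, ← mul_sum, hb, sum_mul]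
  have hz := tsum_one_div_pow_two_mul (show n ≠ 0 by omega)
  have hp : (2 : ℝ) ^ (2 * n - 1) = 2 * 2 ^ (2 * n - 2) := by
    rw [← pow_succ']; congr 1; omega
  rw [hp, pow_succ] at hz
  linear_combination h2 / 2 - ((2 * n - 1).choose (n - 1) - (-1) ^ n / 2) / 2 * hz

/-! ### Assembling the identity. -/

theorem factorial_div_eq_choose {n : ℕ} (hn : 1 ≤ n) (j : ℕ) :
    ((n + j).factorial : ℂ) / (((n + j : ℕ) : ℂ) * (j.factorial : ℂ)) =
      ((n - 1).factorial : ℂ) * ((n - 1 + j).choose (n - 1) : ℂ) := by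
  obtain ⟨p, rfl⟩ : ∃ p, n = p + 1 := ⟨n - 1, by omega⟩
  have h := Nat.add_choose_mul_factorial_mul_factorial p j
  rw [← Nat.choose_symm_add] at h
  have h' : ((p + j).choose p : ℂ) * p.factorial * j.factorial = ((p + j).factorial : ℂ) := by
    exact_mod_cast h
  have e1 : (j.factorial : ℂ) ≠ 0 := by exact_mod_cast j.factorial_ne_zero
  have e2 : ((p + 1 + j : ℕ) : ℂ) ≠ 0 := by exact_mod_cast (by omega : p + 1 + j ≠ 0)
  rw [div_eq_iff (mul_ne_zero e2 e1), show p + 1 + j = p + j + 1 by ring, Nat.factorial_succ,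
    Nat.add_sub_cancel, Nat.cast_mul, ← h']
  ring

theorem mainTheorem11 (n : ℕ) (hn : 2 ≤ n) :
    IsGaussContinuation 1 (2 * n + 2) (n + 2) (gaussHypergeometric 1 (2 * n + 2) (n + 2)) ∧
    ∑ k ∈ Finset.Icc 1 (n - 1),
        ((n + ((n : ℤ) - 2 * k).natAbs).factorial : ℂ) /
            (((n + ((n : ℤ) - 2 * k).natAbs : ℕ) : ℂ) * (((n : ℤ) - 2 * k).natAbs.factorial : ℂ)) *
          (doubleZeta (2 * k) (2 * n - 2 * k) : ℂ) =
      ((1 + (-2 : ℂ) ^ (1 - (n : ℤ))) * ((n - 1).factorial : ℂ) / 4 +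
          3 * ((2 * n - 1).factorial : ℂ) / (2 * (n.factorial : ℂ)) -
          ((2 * n + 1).factorial : ℂ) / ((n : ℂ) * ((n + 1).factorial : ℂ)) *
            gaussHypergeometric 1 (2 * n + 2) (n + 2) (-1)) *
        riemannZeta (2 * n) := by
  refine ⟨isGaussContinuation_gaussHypergeometric n, ?_⟩
  have hI : Finset.Icc 1 (n - 1) = Finset.Ico 1 n := by
    ext k; simp only [Finset.mem_Icc, Finset.mem_Ico]; omega
  have hz : riemannZeta (2 * n) = ((∑' m : ℕ, 1 / (m : ℝ) ^ (2 * n) : ℝ) : ℂ) := by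
    have := zeta_nat_eq_tsum_of_gt_one (show 1 < 2 * n by omega)
    push_cast at this ⊢
    exact this
  have hD := congrArg (Complex.ofReal) (sum_choose_natAbs_mul_doubleZeta hn)
  have hW : ∑ k ∈ Finset.Ico 1 n, ((n - 1 + ((n : ℤ) - 2 * k).natAbs).choose (n - 1) : ℂ) =
      2 * ((-1) ^ n * ∑ i ∈ Finset.range (n + 1), ((n + i).choose n : ℂ) * (-1) ^ i) -
        2 * ((2 * n - 1).choose (n - 1) : ℂ) - (1 + (-1) ^ n) / 2 := by
    exact_mod_cast congrArg (Rat.cast : ℚ → ℂ) (sum_choose_natAbs hn)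
  have hF := gaussHypergeometric_neg_one n
  have hn0 : (n : ℂ) ≠ 0 := by exact_mod_cast (by omega : n ≠ 0)
  have e1 : ((n + 1).factorial : ℂ) ≠ 0 := by exact_mod_cast (n + 1).factorial_ne_zero
  have hnf : (n.factorial : ℂ) = n * ((n - 1).factorial : ℂ) := by
    exact_mod_cast (Nat.mul_factorial_pred (by omega)).symm
  have c1 : ((2 * n + 1).factorial : ℂ) / ((n : ℂ) * ((n + 1).factorial : ℂ)) =
      ((n - 1).factorial : ℂ) * ((2 * n + 1).choose n : ℂ) := by
    have h : ((2 * n + 1).choose n : ℂ) * n.factorial * (n + 1).factorial =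
        ((2 * n + 1).factorial : ℂ) := by
      have := Nat.choose_mul_factorial_mul_factorial (show n ≤ 2 * n + 1 by omega)
      rw [show 2 * n + 1 - n = n + 1 by omega] at this
      exact_mod_cast this
    rw [div_eq_iff (mul_ne_zero hn0 e1), ← h, hnf]
    ring
  have c2 : ((2 * n - 1).factorial : ℂ) / (n.factorial : ℂ) =
      ((n - 1).factorial : ℂ) * ((2 * n - 1).choose (n - 1) : ℂ) := by
    have h : ((2 * n - 1).choose (n - 1) : ℂ) * (n - 1).factorial * n.factorial =
        ((2 * n - 1).factorial : ℂ) := by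
      have := Nat.choose_mul_factorial_mul_factorial (show n - 1 ≤ 2 * n - 1 by omega)
      rw [show 2 * n - 1 - (n - 1) = n by omega] at this
      exact_mod_cast this
    rw [div_eq_iff (by exact_mod_cast n.factorial_ne_zero), ← h]
    ring
  -- In this form the power of `-2` cancels the term `(-1) ^ n / 2 ^ (n + 1)` of the hypergeometric
  -- value.
  have c3 : (-2 : ℂ) ^ (1 - (n : ℤ)) = -4 * ((-1) ^ n / 2 ^ (n + 1)) := by
    have h1 : (-1 : ℂ) ^ n * (-1) ^ n = 1 := by rw [← mul_pow]; norm_num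
    have h2 : (-1 : ℂ) ^ n ≠ 0 := pow_ne_zero _ (by norm_num)
    rw [zpow_sub₀ (by norm_num), zpow_one, zpow_natCast, neg_pow, pow_succ]
    field_simp
    linear_combination 4 * h1
  have c4 : 3 * ((2 * n - 1).factorial : ℂ) / (2 * (n.factorial : ℂ)) =
      3 / 2 * (((n - 1).factorial : ℂ) * ((2 * n - 1).choose (n - 1) : ℂ)) := by
    rw [← c2]; ring
  rw [hI, hz, c1, c3, c4, mul_assoc ((n - 1).factorial : ℂ) ((2 * n + 1).choose n : ℂ), hF]
  simp only [factorial_div_eq_choose (show 1 ≤ n by omega), mul_assoc ((n - 1).factorial : ℂ)]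
  rw [← Finset.mul_sum]
  have hD' : ∑ k ∈ Finset.Ico 1 n, ((n - 1 + ((n : ℤ) - 2 * k).natAbs).choose (n - 1) : ℂ) *
      (doubleZeta (2 * k) (2 * n - 2 * k) : ℂ) =
    ((2 * n - 1).choose (n - 1) - (-1) ^ n / 2 -
      ∑ k ∈ Finset.Ico 1 n, ((n - 1 + ((n : ℤ) - 2 * k).natAbs).choose (n - 1) : ℂ)) / 2 *
      ((∑' m : ℕ, 1 / (m : ℝ) ^ (2 * n) : ℝ) : ℂ) := by
    rw [Complex.ofReal_sum, Complex.ofReal_mul] at hD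
    simp only [Complex.ofReal_mul, Complex.ofReal_div, Complex.ofReal_sub, Complex.ofReal_sum,
      Complex.ofReal_natCast, Complex.ofReal_pow, Complex.ofReal_neg, Complex.ofReal_one,
      Complex.ofReal_ofNat] at hD ⊢
    exact hD
  rw [hD', hW]
  ring
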